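/- Let $g\ge 2$ and $m\ge 1$, let $$\pi_1(\Sigma_g)=\langle x_1,\dots,x_{2g}\mid [x_1,x_2]\cdots[x_{2g-1},x_{2g}]\rangle$$ be the fundamental group of the closed orientable surface of genus $g$, and let $G=\pi_1(\Sigma_g)\times\mathbb Z^m$. Write the elements of $G$ as $u\mathbf t^{\mathbf a}$ with $u\in\pi_1(\Sigma_g)$ and $\mathbf a\in\mathbb Z^m$ a row vector, and let $\mathbf u\in\mathbb Z^{2g}$ denote the abelianization of $u$, that is, its image under the homomorphism $\pi_1(\Sigma_g)\to\mathbb Z^{2g}$ sending $x_i$ to the $i$-th standard basis (row) vector. For $\phi\in\mathrm{End}(\pi_1(\Sigma_g))$, $\mathbf Q\in\mathcal M_m(\mathbb Z)$ and $\mathbf P\in\mathcal M_{2g\times m}(\mathbb Z)$ let $\Psi_{\phi,\mathbf Q,\mathbf P}\in\mathrm{End}(G)$ be the endomorphism $$\Psi_{\phi,\mathbf Q,\mathbf P}:\ u\mathbf t^{\mathbf a}\mapsto \phi(u)\,\mathbf t^{\mathbf a\mathbf Q+\mathbf u\mathbf P}.$$ Let $\Psi\in\mathrm{End}(G)$. Then: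 1. $\Psi$ is injective if and only if $\Psi=\Psi_{\phi,\mathbf Q,\mathbf P}$ for some $\phi,\mathbf Q,\mathbf P$ with $\phi$ injective and $\det\mathbf Q\ne 0$. 2. $\Psi$ is surjective if and only if $\Psi=\Psi_{\phi,\mathbf Q,\mathbf P}$ for some $\phi,\mathbf Q,\mathbf P$ with $\phi$ surjective and $\det\mathbf Q=\pm1$. 3. $\Psi$ is an automorphism if and only if it is surjective. Hence $G$ is Hopfian (every surjective endomorphism is an automorphism) but not co-Hopfian (not every injective endomorphism is an automorphism). Moreover, whenever $\Psi_{\phi,\mathbf Q,\mathbf P}$ is surjective, $\phi$ is an automorphism of $\pi_1(\Sigma_g)$, $\mathbf Q\in\mathrm{GL}_m(\mathbb Z)$, the matrix $\mathbf M$ of the map induced by $\phi$ on $\mathbb Z^{2g}$ (whose $i$-th row is the abelianization of $\phi(x_i)$) lies in $\mathrm{GL}_{2g}(\mathbb Z)$, and $$(\Psi_{\phi,\mathbf Q,\mathbf P})^{-1}=\Psi_{\phi^{-1},\,\mathbf Q^{-1},\,-\mathbf M^{-1}\mathbf P\mathbf Q^{-1}}.$$ -/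

import Mathlib

namespace SurfaceTimesAbelian

open scoped commutatorElement

/-- The word `[x₁, x₂] ⋯ [x_{2g-1}, x_{2g}]` in the free group on `2g` letters
(the letters are indexed from `0`). -/
def surfaceRelator (g : ℕ) : FreeGroup (Fin (2 * g)) :=
  ((List.finRange g).map fun i : Fin g =>
    ⁅FreeGroup.of (⟨2 * i.val, by omega⟩ : Fin (2 * g)),
      FreeGroup.of (⟨2 * i.val + 1, by omega⟩ : Fin (2 * g))⁆).prod

/-- The fundamental group `π₁(Σ_g)` of the closed orientable surface of genus `g`, by its
standard presentation. -/
abbrev SurfaceGroup (g : ℕ) : Type :=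
  PresentedGroup ({surfaceRelator g} : Set (FreeGroup (Fin (2 * g))))

/-- The standard generators `x_i` of `π₁(Σ_g)`. -/
def gen (g : ℕ) (i : Fin (2 * g)) : SurfaceGroup g :=
  PresentedGroup.of i

/-- `ℤ^m`, written multiplicatively; the element `t^a` is `Multiplicative.ofAdd a`. -/
abbrev FreeAb (m : ℕ) : Type := Multiplicative (Fin m → ℤ)

/-- `G = π₁(Σ_g) × ℤ^m`; the element `u t^a` is the pair `(u, Multiplicative.ofAdd a)`. -/
abbrev SurfaceAb (g m : ℕ) : Type := SurfaceGroup g × FreeAb m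

theorem lift_surfaceRelator {A : Type*} [CommGroup A] (g : ℕ) (f : Fin (2 * g) → A) :
    FreeGroup.lift f (surfaceRelator g) = 1 := by
  rw [surfaceRelator, map_list_prod, List.map_map]
  apply List.prod_eq_one
  intro y hy
  obtain ⟨i, -, rfl⟩ := List.mem_map.1 hy
  simp [commutatorElement_def, mul_comm]

/-- The abelianization homomorphism `π₁(Σ_g) → ℤ^{2g}`, sending `x_i` to the `i`-th standard
basis vector. -/
def abHom (g : ℕ) : SurfaceGroup g →* Multiplicative (Fin (2 * g) → ℤ) :=
  PresentedGroup.toGroup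
    (f := fun i => Multiplicative.ofAdd (Pi.single i (1 : ℤ)))
    (by
      intro r hr
      rw [Set.mem_singleton_iff.1 hr]
      exact lift_surfaceRelator g _)

/-- The abelianization of `u ∈ π₁(Σ_g)`, as a row vector in `ℤ^{2g}`. -/
def ab {g : ℕ} (u : SurfaceGroup g) : Fin (2 * g) → ℤ :=
  Multiplicative.toAdd (abHom g u)

theorem ab_mul {g : ℕ} (u v : SurfaceGroup g) : ab (u * v) = ab u + ab v := by
  simp [ab]

theorem ab_one {g : ℕ} : ab (1 : SurfaceGroup g) = 0 := by
  simp [ab]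

theorem ab_gen {g : ℕ} (i : Fin (2 * g)) : ab (gen g i) = Pi.single i 1 := by
  simp [ab, gen, abHom]

/-- The endomorphism of the first kind
`Ψ_{φ,Q,P} : u t^a ↦ φ(u) t^(aQ + uP)`, where in the exponent `u` stands for its
abelianization; vectors are row vectors. -/
def firstKind {g m : ℕ} (φ : SurfaceGroup g →* SurfaceGroup g)
    (Q : Matrix (Fin m) (Fin m) ℤ) (P : Matrix (Fin (2 * g)) (Fin m) ℤ) :
    SurfaceAb g m →* SurfaceAb g m where
  toFun w := (φ w.1,
    Multiplicative.ofAdd (Matrix.vecMul (Multiplicative.toAdd w.2) Q + Matrix.vecMul (ab w.1) P))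
  map_one' := by
    simp [ab_one]
  map_mul' v w := by
    refine Prod.ext (by simp) ?_
    apply Multiplicative.toAdd.injective
    simp only [Prod.fst_mul, Prod.snd_mul, Prod.mk_mul_mk, toAdd_mul, toAdd_ofAdd, ab_mul,
      Matrix.add_vecMul]
    abel

/-- The matrix of the endomorphism of `ℤ^{2g}` induced by `φ` (acting on row vectors): its
`i`-th row is the abelianization of `φ(x_i)`. -/
def abMatrix {g : ℕ} (φ : SurfaceGroup g →* SurfaceGroup g) :
    Matrix (Fin (2 * g)) (Fin (2 * g)) ℤ :=
  Matrix.of fun i => ab (φ (gen g i))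

/-- The matrix `abMatrix φ` does represent the abelianization of `φ`. -/
theorem ab_map {g : ℕ} (φ : SurfaceGroup g →* SurfaceGroup g) (u : SurfaceGroup g) :
    ab (φ u) = Matrix.vecMul (ab u) (abMatrix φ) := by
  let L : SurfaceGroup g →* Multiplicative (Fin (2 * g) → ℤ) := (abHom g).comp φ
  let R : SurfaceGroup g →* Multiplicative (Fin (2 * g) → ℤ) :=
    (AddMonoidHom.toMultiplicative (Matrix.vecMulLinear (abMatrix φ)).toAddMonoidHom).comp
      (abHom g)
  have h : L = R := by
    apply PresentedGroup.ext
    intro i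
    apply Multiplicative.toAdd.injective
    change ab (φ (gen g i)) = Matrix.vecMul (ab (gen g i)) (abMatrix φ)
    rw [ab_gen, Matrix.single_one_vecMul]
    rfl
  exact congrArg Multiplicative.toAdd (DFunLike.congr_fun h u)

/-- A group is Hopfian if each of its epimorphisms onto itself is an automorphism. -/
def IsHopfian (G : Type*) [Group G] : Prop :=
  ∀ f : G →* G, Function.Surjective f → Function.Bijective f

/-- A group is co-Hopfian if each of its monomorphisms into itself is an automorphism. -/
def IsCoHopfian (G : Type*) [Group G] : Prop :=
  ∀ f : G →* G, Function.Injective f → Function.Bijective f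

end SurfaceTimesAbelian

/-! Write S for the surface group. Two facts about S carry the theorem: it is non-abelian and
commutation transitive (hence centreless), and it is Hopfian. Since t^a is central in G, the
S-component of its image commutes with the S-components of all images. If Ψ is onto, that component
is central in S, hence trivial. If Ψ is injective and the component is nontrivial, transitivity
makes all S-components of images commute, and injectivity then makes S abelian, a contradiction. So
Ψ maps ℤ^m into itself, which forces the form Ψ_{φ,Q,P} (`exists_eq_firstKind`); the rest is linear
algebra over ℤ and Hopficity of S.

Both facts come from an infinite cyclic cover. With t, a the first two generators and R₀ the product
of the other commutators, the relation reads t a t⁻¹ = R₀⁻¹ a. Hence S embeds in F ⋊ ℤ, where F is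
free on a and on letters standing for the conjugates t^i x t^(-i), and t acts by `shift`.
Commutation transitivity follows from that of F, because no nonzero power of the shift fixes a
nontrivial conjugacy class of F (`eq_one_of_isConj_shift_zpow`). Hopficity is Malcev's argument: F ⋊
ℤ is residually finite, since every nontrivial element of F survives in a finite representation
invariant under some power of the shift (`exists_shift_invariant_perm_ne_one`). -/

namespace SurfaceTimesAbelian

open scoped commutatorElement

/-! ### Commutation transitivity, and its proof for free groups. -/

/-- A group is commutation transitive if commuting is a transitive relation on its nontrivial
elements. -/
def IsCommTransitive (G : Type*) [Group G] : Prop :=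
  ∀ x y z : G, y ≠ 1 → Commute x y → Commute y z → Commute x z

theorem IsCommTransitive.of_injective {G H : Type*} [Group G] [Group H] (hH : IsCommTransitive H)
    (f : G →* H) (hf : Function.Injective f) : IsCommTransitive G := by
  intro x y z hy hxy hyz
  have h := hH (f x) (f y) (f z) (fun h => hy (hf (h.trans f.map_one.symm)))
    (hxy.map f) (hyz.map f)
  exact hf (by simpa using h.eq)

theorem IsCommTransitive.eq_one_of_central {G : Type*} [Group G] (hG : IsCommTransitive G)
    {a b : G} (hab : ¬ Commute a b) {z : G} (hz : ∀ x, Commute x z) : z = 1 := by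
  by_contra hne
  exact hab (hG a z b hne (hz a) (hz b).symm)

/-- A free group in which all elements commute has at most one generator. -/
theorem freeGroup_subsingleton_of_commute {α : Type*} (h : ∀ x y : FreeGroup α, Commute x y) :
    Subsingleton α := by
  classical
  refine ⟨fun a b => ?_⟩
  by_contra hab
  let f : FreeGroup α →* Equiv.Perm (Fin 3) :=
    FreeGroup.lift fun c => if c = a then Equiv.swap 0 1 else Equiv.swap 1 2
  have h1 := ((h (FreeGroup.of a) (FreeGroup.of b)).map f).eq
  simp only [f, FreeGroup.lift_apply_of, if_true, if_neg (Ne.symm hab)] at h1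
  exact absurd h1 (by decide)

/-- Two commuting elements of a free group are powers of a common element. -/
theorem freeGroup_exists_zpow_of_commute {α : Type*} {x y : FreeGroup α} (h : Commute x y) :
    ∃ (u : FreeGroup α) (i j : ℤ), x = u ^ i ∧ y = u ^ j := by
  let H : Subgroup (FreeGroup α) := Subgroup.closure {x, y}
  have hH : ∀ a b : H, Commute a b := by
    have hc : ∀ p ∈ ({x, y} : Set (FreeGroup α)), ∀ q ∈ ({x, y} : Set (FreeGroup α)),
        p * q = q * p := by
      rintro p (rfl | rfl) q (rfl | rfl)
      · rfl
      · exact h.eq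
      · exact h.eq.symm
      · rfl
    have := Subgroup.isMulCommutative_closure hc
    intro a b
    exact this.is_comm.comm a b
  -- Nielsen–Schreier: the abelian subgroup `H` is free, hence of rank at most one.
  let e := IsFreeGroup.toFreeGroup H
  have hs : Subsingleton (IsFreeGroup.Generators H) := by
    apply freeGroup_subsingleton_of_commute
    intro p q
    have := (hH (e.symm p) (e.symm q)).map e
    simpa using this
  have hcyc : ∃ v : FreeGroup (IsFreeGroup.Generators H), ∀ p, ∃ i : ℤ, p = v ^ i := by
    rcases isEmpty_or_nonempty (IsFreeGroup.Generators H) with hE | ⟨⟨c⟩⟩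
    · exact ⟨1, fun p => ⟨0, Subsingleton.elim _ _⟩⟩
    · refine ⟨FreeGroup.of c, fun p => ?_⟩
      have hp : p ∈ Subgroup.zpowers (FreeGroup.of c) := by
        induction p using FreeGroup.induction_on with
        | C1 => exact one_mem _
        | of d => rw [Subsingleton.elim d c]; exact Subgroup.mem_zpowers _
        | inv_of d hd => exact inv_mem hd
        | mul a b ha hb => exact mul_mem ha hb
      obtain ⟨i, hi⟩ := hp
      exact ⟨i, hi.symm⟩
  obtain ⟨v, hv⟩ := hcyc
  have key : ∀ p : H, ∃ i : ℤ, (p : FreeGroup α) = ((e.symm v : H) : FreeGroup α) ^ i := by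
    intro p
    obtain ⟨i, hi⟩ := hv (e p)
    refine ⟨i, ?_⟩
    rw [← Subgroup.coe_zpow, ← map_zpow, ← hi, MulEquiv.symm_apply_apply]
  obtain ⟨i, hi⟩ := key ⟨x, Subgroup.subset_closure (by simp)⟩
  obtain ⟨j, hj⟩ := key ⟨y, Subgroup.subset_closure (by simp)⟩
  exact ⟨_, i, j, hi, hj⟩

/-- Roots in a free group are unique, so whatever commutes with a nontrivial power of `u` commutes
with `u`. -/
theorem freeGroup_isCommTransitive (α : Type*) : IsCommTransitive (FreeGroup α) := by
  intro x y z hy hxy hyz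
  obtain ⟨u, i, j, rfl, rfl⟩ := freeGroup_exists_zpow_of_commute hyz
  have hi : i ≠ 0 := by
    rintro rfl
    simp at hy
  have hxu : x * u * x⁻¹ = u := by
    apply zpow_left_injective hi
    change (x * u * x⁻¹) ^ i = u ^ i
    rw [conj_zpow, hxy.eq, mul_inv_cancel_right]
  have hxu' : Commute x u := by
    rwa [mul_inv_eq_iff_eq_mul] at hxu
  exact hxu'.zpow_right j

/-! ### Finite permutation representations and Malcev's argument. -/

/-- Left multiplication by `x`, where it maps an element of the finite set `B` into `B`, extends
to a permutation of `B`. -/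
theorem exists_perm_extending_mul {G : Type*} [Group G] (B : Finset G) (x : G) :
    ∃ π : Equiv.Perm B, ∀ b c : B, x * (b : G) = c → π b = c := by
  classical
  obtain ⟨π, hπ⟩ := Finset.exists_equiv_extend_of_card_eq (α := B) (t := B) (by simp)
    (s := Finset.univ.filter fun b : B => x * (b : G) ∈ B) (f := fun b => x * (b : G))
    (by
      intro c hc
      obtain ⟨b, hb, rfl⟩ := Finset.mem_image.1 hc
      exact (Finset.mem_filter.1 hb).2)
    (by
      intro b _ c _ h
      exact Subtype.ext (mul_left_cancel h))
  refine ⟨π, fun b c h => Subtype.ext ?_⟩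
  rw [hπ b (by simp [h]), h]

/-- A nontrivial element of a free group acts nontrivially in some finite permutation action. -/
theorem freeGroup_exists_perm_ne_one {α : Type*} {w : FreeGroup α} (hw : w ≠ 1) :
    ∃ (B : Finset (FreeGroup α)) (ρ : FreeGroup α →* Equiv.Perm B), ρ w ≠ 1 := by
  classical
  obtain ⟨L, rfl⟩ : ∃ L, FreeGroup.mk L = w := ⟨w.toWord, FreeGroup.mk_toWord⟩
  -- The suffixes of the word are the points visited when it is applied to 1 letter by letter; each
  -- generator acts on them as a partial injection, which extends to a permutation.
  let B : Finset (FreeGroup α) := (L.tails.map FreeGroup.mk).toFinset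
  have hB : ∀ T, T <:+ L → FreeGroup.mk T ∈ B := fun T hT => by
    simp only [B, List.mem_toFinset, List.mem_map, List.mem_tails]
    exact ⟨T, hT, rfl⟩
  choose π hπ using exists_perm_extending_mul B
  let ρ : FreeGroup α →* Equiv.Perm B := FreeGroup.lift fun a => π (FreeGroup.of a)
  have key : ∀ T (hT : T <:+ L),
      ρ (FreeGroup.mk T) ⟨FreeGroup.mk [], hB [] (List.nil_suffix)⟩ = ⟨FreeGroup.mk T, hB T hT⟩ := by
    intro T
    induction T with
    | nil =>
      intro hT
      have h1 : ρ (FreeGroup.mk []) = 1 := map_one ρ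
      rw [h1]
      rfl
    | cons p T ih =>
      intro hT
      have hT' : T <:+ L := (List.suffix_cons p T).trans hT
      obtain ⟨a, b⟩ := p
      have hmul : FreeGroup.mk ((a, b) :: T) = FreeGroup.mk [(a, b)] * FreeGroup.mk T := by
        simp
      have hcongr : ρ (FreeGroup.mk ((a, b) :: T)) = ρ (FreeGroup.mk [(a, b)]) * ρ (FreeGroup.mk T) := by
        rw [hmul, map_mul]
      rw [hcongr, Equiv.Perm.mul_apply, ih hT']
      cases b with
      | true =>
        have h1 : ρ (FreeGroup.mk [(a, true)]) = π (FreeGroup.of a) := by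
          change ρ (FreeGroup.of a) = _
          simp [ρ]
        rw [h1]
        exact hπ _ _ _ hmul.symm
      | false =>
        have h0 : FreeGroup.mk [(a, false)] = (FreeGroup.of a)⁻¹ := by
          rfl
        have h1 : ρ (FreeGroup.mk [(a, false)]) = (π (FreeGroup.of a))⁻¹ := by
          rw [h0, map_inv]
          simp [ρ]
        rw [h1, Equiv.Perm.inv_eq_iff_eq]
        refine (hπ _ _ _ ?_).symm
        change FreeGroup.of a * FreeGroup.mk ((a, false) :: T) = FreeGroup.mk T
        rw [hmul, h0, mul_inv_cancel_left]
  refine ⟨B, ρ, fun h => hw ?_⟩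
  have h1 := key L (List.suffix_refl L)
  rw [h] at h1
  exact (congrArg Subtype.val h1).symm

/-- Every permutation of a finite set becomes a commutator in a larger symmetric group. -/
theorem exists_embedding_perm_commutator {B : Type*} [Finite B] (r : Equiv.Perm B) :
    ∃ (ι : Equiv.Perm B →* Equiv.Perm (B ⊕ B)) (y z : Equiv.Perm (B ⊕ B)),
      Function.Injective ι ∧ ι r = ⁅y, z⁆ := by
  classical
  cases nonempty_fintype B
  -- As `s` conjugates `r` to `r⁻¹`, the embedding `p ↦ (p, s p s⁻¹)` sends `r` to `(r, r⁻¹)`, the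
  -- commutator of `(r, 1)` with the swap of the two copies of `B`.
  obtain ⟨s, hs⟩ := isConj_iff.1
    (Equiv.Perm.isConj_iff_cycleType_eq.2 (Equiv.Perm.cycleType_inv r).symm)
  let ι : Equiv.Perm B →* Equiv.Perm (B ⊕ B) :=
    (Equiv.Perm.sumCongrHom B B).comp
      ((MonoidHom.id _).prod (MulAut.conj s).toMonoidHom)
  refine ⟨ι, Equiv.Perm.sumCongrHom B B (r, 1), Equiv.sumComm B B, ?_, ?_⟩
  · intro p q h
    exact congrArg Prod.fst (Equiv.Perm.sumCongrHom_injective h)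
  · have h1 : ι r = Equiv.Perm.sumCongrHom B B (r, r⁻¹) := by
      simp [ι, hs]
    rw [h1, commutatorElement_def, ← map_inv]
    ext x
    have hsymm : (Equiv.sumComm B B : Equiv.Perm (B ⊕ B))⁻¹ = Equiv.sumComm B B := rfl
    rw [hsymm]
    rcases x with x | x <;> rfl

/-- Finitely generated residually finite groups are Hopfian. -/
theorem isHopfian_of_residuallyFinite (G : Type*) [Group G] [Group.ResiduallyFinite G]
    {ι : Type*} [Finite ι] (x : ι → G) (hx : Subgroup.closure (Set.range x) = ⊤) :
    IsHopfian G := by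
  intro f hf
  refine ⟨(injective_iff_map_eq_one f).2 fun w hw => ?_, hf⟩
  by_contra hne
  obtain ⟨H, hH⟩ := Group.exists_finiteIndexNormalSubgroup_notMem w hne
  let Q := G ⧸ H.toSubgroup
  have hfin : Finite (G →* Q) := by
    refine Finite.of_injective (fun (k : G →* Q) (i : ι) => k (x i)) fun k l h => ?_
    refine MonoidHom.eq_of_eqOn_dense hx ?_
    rintro _ ⟨i, rfl⟩
    exact congrFun h i
  -- Precomposition with `f` is then a bijection of the finite set Hom(G, Q), so the quotient map
  -- factors through `f` and kills its kernel.
  have hinj : Function.Injective fun k : G →* Q => k.comp f := fun k l h =>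
    (MonoidHom.cancel_right hf).1 h
  obtain ⟨k, hk⟩ := (Finite.surjective_of_injective hinj) (QuotientGroup.mk' H.toSubgroup)
  apply hH
  have := DFunLike.congr_fun hk w
  simp only [MonoidHom.comp_apply, hw, map_one] at this
  exact (QuotientGroup.eq_one_iff w).1 this.symm

/-! ### The infinite cyclic cover and its shift. -/

/-- The product of the commutators `[f (l, false), f (l, true)]`. -/
def commProd {H : Type*} [Group H] {h : ℕ} (f : Fin h × Bool → H) : H :=
  ((List.finRange h).map fun l => ⁅f (l, false), f (l, true)⁆).prod

theorem map_commProd {H K : Type*} [Group H] [Group K] {h : ℕ} (ψ : H →* K)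
    (f : Fin h × Bool → H) : ψ (commProd f) = commProd fun p => ψ (f p) := by
  simp only [commProd, map_list_prod, List.map_map]
  congr 2
  funext l
  simp [map_commutatorElement]

theorem commProd_one {H : Type*} [Group H] {h : ℕ} :
    commProd (fun _ : Fin h × Bool => (1 : H)) = 1 :=
  List.prod_eq_one fun y hy => by
    obtain ⟨l, -, rfl⟩ := List.mem_map.1 hy
    simp

/-- The family of pairs whose first pair is `(y, z)` and whose other pairs are trivial. -/
def firstPair {H : Type*} [Group H] {h : ℕ} (y z : H) (p : Fin h × Bool) : H :=
  if p.1.val = 0 then (if p.2 then z else y) else 1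

theorem commProd_firstPair {H : Type*} [Group H] {h : ℕ} (hh : 0 < h) (y z : H) :
    commProd (firstPair y z : Fin h × Bool → H) = ⁅y, z⁆ := by
  obtain ⟨h, rfl⟩ : ∃ k, h = k + 1 := ⟨h - 1, by omega⟩
  rw [commProd, List.finRange_succ, List.map_cons, List.prod_cons, List.map_map,
    List.prod_eq_one]
  · simp [firstPair]
  · intro x hx
    obtain ⟨l, -, rfl⟩ := List.mem_map.1 hx
    simp [firstPair]

/-- The free group on letters `x (i, p)`, with `i` an integer and `p ∈ Fin h × Bool`, and one more
letter. -/
abbrev CoverGroup (h : ℕ) : Type := FreeGroup (Option (ℤ × Fin h × Bool))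

/-- The letter `x (i, p)`. -/
def xg {h : ℕ} (i : ℤ) (p : Fin h × Bool) : CoverGroup h := FreeGroup.of (some (i, p))

/-- The letter `a`. -/
def ag {h : ℕ} : CoverGroup h := FreeGroup.of none

/-- The product of commutators of the letters at level `i`. -/
def levelProd {h : ℕ} (i : ℤ) : CoverGroup h := commProd (xg i)

/-- The homomorphism with given values on the letters. -/
def coverLift {H : Type*} [Group H] {h : ℕ} (X : ℤ → Fin h × Bool → H) (A : H) :
    CoverGroup h →* H :=
  FreeGroup.lift fun o => o.elim A fun q => X q.1 q.2

@[simp] theorem coverLift_xg {H : Type*} [Group H] {h : ℕ} (X : ℤ → Fin h × Bool → H) (A : H)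
    (i : ℤ) (p : Fin h × Bool) : coverLift X A (xg i p) = X i p := by
  simp [coverLift, xg]

@[simp] theorem coverLift_ag {H : Type*} [Group H] {h : ℕ} (X : ℤ → Fin h × Bool → H) (A : H) :
    coverLift X A ag = A := by
  simp [coverLift, ag]

theorem coverGroup_hom_ext {H : Type*} [Group H] {h : ℕ} {f k : CoverGroup h →* H}
    (hx : ∀ i p, f (xg i p) = k (xg i p)) (ha : f ag = k ag) : f = k := by
  apply FreeGroup.ext_hom
  rintro (_ | ⟨i, p⟩)
  · exact ha
  · exact hx i p

theorem map_levelProd {H : Type*} [Group H] {h : ℕ} (f : CoverGroup h →* H) (i : ℤ) :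
    f (levelProd i) = commProd fun p => f (xg i p) :=
  map_commProd f _

/-- The automorphism `x (i, p) ↦ x (i + 1, p)`, `a ↦ R₀⁻¹ a`. -/
def shift (h : ℕ) : MulAut (CoverGroup h) :=
  MonoidHom.toMulEquiv
    (coverLift (fun i p => xg (i + 1) p) ((levelProd 0)⁻¹ * ag))
    (coverLift (fun i p => xg (i - 1) p) (levelProd (-1) * ag))
    (coverGroup_hom_ext (by simp) (by
      simp [map_levelProd]
      simp [levelProd]))
    (coverGroup_hom_ext (by simp) (by
      simp [map_levelProd]
      simp [levelProd]))

theorem shift_xg {h : ℕ} (i : ℤ) (p : Fin h × Bool) : shift h (xg i p) = xg (i + 1) p :=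
  coverLift_xg (fun i p => xg (i + 1) p) ((levelProd 0)⁻¹ * ag) i p

theorem shift_ag {h : ℕ} : shift h ag = (levelProd 0)⁻¹ * ag :=
  coverLift_ag (fun i p => xg (i + 1) p) _

theorem shift_pow_xg {h : ℕ} (n : ℕ) (i : ℤ) (p : Fin h × Bool) :
    (shift h ^ n) (xg i p) = xg (i + n) p := by
  induction n with
  | zero => simp
  | succ n ih =>
    rw [pow_succ', MulAut.mul_apply, ih, shift_xg]
    congr 1
    push_cast
    ring

theorem shift_pow_levelProd {h : ℕ} (n : ℕ) (i : ℤ) :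
    (shift h ^ n) (levelProd i) = levelProd (i + n) := by
  have := map_levelProd (shift h ^ n : MulAut (CoverGroup h)).toMonoidHom i
  simpa [shift_pow_xg, levelProd] using this

/-- Iterating gives `a ↦ R_{n-1}⁻¹ ⋯ R_0⁻¹ a` under `shift ^ n`: exactly the levels below `n` are
introduced. -/
theorem shift_pow_succ_ag {h : ℕ} (n : ℕ) :
    (shift h ^ (n + 1)) ag = (levelProd n)⁻¹ * (shift h ^ n) ag := by
  rw [pow_succ, MulAut.mul_apply, shift_ag, map_mul, map_inv, shift_pow_levelProd, zero_add]

/-! ### Windows of levels. -/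

/-- The endomorphism killing the letters `x (i, p)` with `i ∉ I`. -/
noncomputable def restrict {h : ℕ} (I : Set ℤ) : CoverGroup h →* CoverGroup h :=
  open Classical in coverLift (fun i p => if i ∈ I then xg i p else 1) ag

theorem restrict_xg_mem {h : ℕ} {I : Set ℤ} {i : ℤ} (hi : i ∈ I) (p : Fin h × Bool) :
    restrict I (xg i p) = xg i p := by
  simp [restrict, hi]

theorem restrict_xg_notMem {h : ℕ} {I : Set ℤ} {i : ℤ} (hi : i ∉ I) (p : Fin h × Bool) :
    restrict I (xg i p) = 1 := by
  simp [restrict, hi]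

theorem restrict_ag {h : ℕ} (I : Set ℤ) : restrict I (ag : CoverGroup h) = ag := by
  simp [restrict]

theorem restrict_levelProd_mem {h : ℕ} {I : Set ℤ} {i : ℤ} (hi : i ∈ I) :
    restrict I (levelProd i : CoverGroup h) = levelProd i := by
  rw [map_levelProd]
  simp [restrict_xg_mem hi, levelProd]

theorem exists_restrict_eq {h : ℕ} (y : CoverGroup h) :
    ∃ N : ℕ, ∀ n, N ≤ n → restrict (Set.Icc (-n : ℤ) n) y = y := by
  induction y using FreeGroup.induction_on with
  | C1 => exact ⟨0, fun n _ => map_one _⟩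
  | of o =>
    rcases o with _ | ⟨i, p⟩
    · exact ⟨0, fun n _ => restrict_ag _⟩
    · refine ⟨i.natAbs, fun n hn => restrict_xg_mem ?_ p⟩
      constructor <;> omega
  | inv_of o ho =>
    obtain ⟨N, hN⟩ := ho
    exact ⟨N, fun n hn => by rw [map_inv, hN n hn]⟩
  | mul a b ha hb =>
    obtain ⟨N, hN⟩ := ha
    obtain ⟨M, hM⟩ := hb
    refine ⟨max N M, fun n hn => ?_⟩
    rw [map_mul, hN n (le_trans (le_max_left _ _) hn), hM n (le_trans (le_max_right _ _) hn)]

theorem restrict_shift_pow_ag {h : ℕ} {M : ℤ} (n : ℕ) (hn : (n : ℤ) ≤ M + 1) :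
    restrict (Set.Icc 0 M) ((shift h ^ n) ag) = (shift h ^ n) ag := by
  induction n with
  | zero => simp [restrict_ag]
  | succ n ih =>
    rw [shift_pow_succ_ag, map_mul, map_inv, ih (by push_cast at hn; omega),
      restrict_levelProd_mem]
    constructor <;> push_cast at hn <;> omega

/-- If `y` uses levels `-N..N`, shifting by `N` moves them to `0..2N`, and the levels `0..N-1`
created by `a` lie there as well. -/
theorem exists_restrict_shift_eq {h : ℕ} (y : CoverGroup h) :
    ∃ N M : ℕ, restrict (Set.Icc (0 : ℤ) M) ((shift h ^ N) y) = (shift h ^ N) y := by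
  obtain ⟨N, hN⟩ := exists_restrict_eq y
  refine ⟨N, 2 * N, ?_⟩
  have key : (restrict (Set.Icc (0 : ℤ) (2 * N : ℕ))).comp (shift h ^ N).toMonoidHom =
      (shift h ^ N).toMonoidHom.comp (restrict (Set.Icc (-N : ℤ) N)) := by
    apply coverGroup_hom_ext
    · intro i p
      simp only [MonoidHom.comp_apply, MulEquiv.coe_toMonoidHom, shift_pow_xg]
      by_cases hi : i ∈ Set.Icc (-N : ℤ) N
      · rw [restrict_xg_mem hi, shift_pow_xg, restrict_xg_mem]
        obtain ⟨h1, h2⟩ := hi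
        constructor <;> push_cast <;> omega
      · rw [restrict_xg_notMem hi, map_one, restrict_xg_notMem]
        rintro ⟨h1, h2⟩
        push_cast at h2
        exact hi ⟨by omega, by omega⟩
    · simp only [MonoidHom.comp_apply, MulEquiv.coe_toMonoidHom, restrict_ag]
      exact restrict_shift_pow_ag N (by push_cast; omega)
  have := DFunLike.congr_fun key y
  simp only [MonoidHom.comp_apply, MulEquiv.coe_toMonoidHom, hN N le_rfl] at this
  exact this

/-! ### Conjugacy classes under the shift. -/

theorem levelProd_ne_one {h : ℕ} (hh : 0 < h) (i : ℤ) : (levelProd i : CoverGroup h) ≠ 1 := by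
  intro h1
  have h2 := map_levelProd (coverLift (h := h) (fun _ => firstPair
    (Equiv.swap 0 1 : Equiv.Perm (Fin 3)) (Equiv.swap 1 2)) 1) i
  rw [h1, map_one] at h2
  simp only [coverLift_xg] at h2
  rw [commProd_firstPair hh] at h2
  exact absurd h2 (by decide)

/-- The exponent sum of the letter `a`. -/
def agExponent {h : ℕ} : CoverGroup h →* Multiplicative ℤ :=
  coverLift (fun _ _ => 1) (Multiplicative.ofAdd 1)

theorem comp_eq_zpow_agExponent {H : Type*} [Group H] {h : ℕ} {f : CoverGroup h →* H}
    (hx : ∀ i p, f (xg i p) = 1) (y : CoverGroup h) :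
    f y = f ag ^ Multiplicative.toAdd (agExponent y) := by
  have : f = (zpowersHom H (f ag)).comp agExponent := by
    apply coverGroup_hom_ext
    · intro i p
      simp [hx, agExponent]
    · simp [agExponent]
  exact DFunLike.congr_fun this y

/-- The letters of `y` at levels `0..M` move to `K..K+M`, so level `M + 1` can enter the image only
through `a`. Isolating that level shows that `a` has exponent sum 0 in `y`; then killing all levels
outside `0..M` fixes `y` but trivializes its image. -/
theorem eq_one_of_isConj_shift_pow {h : ℕ} (hh : 0 < h) {M : ℕ} {y : CoverGroup h}
    (hy : restrict (Set.Icc (0 : ℤ) M) y = y) {K : ℕ} (hK : M + 2 ≤ K)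
    (hc : IsConj y ((shift h ^ K) y)) : y = 1 := by
  let I : Set ℤ := Set.Icc 0 M
  have hsplit : ∀ (H : Type) (_ : Group H) (f : CoverGroup h →* H),
      (∀ (i : ℤ) p, K ≤ i → i ≤ K + M → f (xg i p) = 1) →
      f ((shift h ^ K) y) = f ((shift h ^ K) ag) ^ Multiplicative.toAdd (agExponent y) := by
    intro H _ f hf
    have h1 := comp_eq_zpow_agExponent
      (f := f.comp ((shift h ^ K).toMonoidHom.comp (restrict I))) (h := h) (by
        intro i p
        simp only [MonoidHom.comp_apply, MulEquiv.coe_toMonoidHom]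
        by_cases hi : i ∈ I
        · rw [restrict_xg_mem hi, shift_pow_xg]
          obtain ⟨h1, h2⟩ := hi
          exact hf _ _ (by omega) (by omega)
        · rw [restrict_xg_notMem hi, map_one, map_one]) y
    simp only [MonoidHom.comp_apply, MulEquiv.coe_toMonoidHom, restrict_ag] at h1
    rwa [hy] at h1
  have hexp : Multiplicative.toAdd (agExponent y) = 0 := by
    classical
    let q : CoverGroup h →* CoverGroup h :=
      coverLift (fun i p => if i = M + 1 then xg i p else 1) 1
    have hqy : q y = 1 := by
      have : q.comp (restrict I) = 1 := by
        apply coverGroup_hom_ext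
        · intro i p
          simp only [MonoidHom.comp_apply, MonoidHom.one_apply]
          by_cases hi : i ∈ I
          · rw [restrict_xg_mem hi, coverLift_xg, if_neg]
            rintro rfl
            have := hi.2
            omega
          · rw [restrict_xg_notMem hi, map_one]
        · simp [restrict_ag, q]
      rw [← hy]
      exact DFunLike.congr_fun this y
    have hqa : ∀ n : ℕ, q ((shift h ^ n) ag) = if M + 2 ≤ n then (levelProd (M + 1))⁻¹ else 1 := by
      intro n
      induction n with
      | zero => simp [q]
      | succ n ih =>
        rw [shift_pow_succ_ag, map_mul, map_inv, ih, map_levelProd]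
        simp only [q, coverLift_xg]
        by_cases hn : n = M + 1
        · subst hn
          simp [levelProd]
        · have hn' : (n : ℤ) ≠ M + 1 := by exact_mod_cast hn
          simp only [hn', if_false, commProd_one, inv_one, one_mul]
          congr 1
          rw [eq_iff_iff]
          omega
    have h1 := hsplit _ _ q (by
      intro i p hi _
      rw [coverLift_xg, if_neg]
      omega)
    rw [hqa K, if_pos hK] at h1
    have h2 : q ((shift h ^ K) y) = 1 := by
      have := q.map_isConj hc
      rw [hqy] at this
      exact isConj_one_right.1 this
    rw [h2] at h1
    -- A nonzero exponent would make the nontrivial element `levelProd (M + 1)` torsion in a free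
    -- group.
    by_contra hne
    have h3 := zpow_left_injective hne (h1.symm.trans (one_zpow _).symm)
    exact levelProd_ne_one hh _ (inv_eq_one.1 h3)
  have h1 := hsplit _ _ (restrict I) (by
    intro i p hi _
    apply restrict_xg_notMem
    rintro ⟨_, h2⟩
    omega)
  rw [hexp, zpow_zero] at h1
  have h2 := (restrict I).map_isConj hc
  rw [h1, hy] at h2
  simpa using h2

/-- No nontrivial conjugacy class is fixed by a nontrivial power of the shift. -/
theorem eq_one_of_isConj_shift_zpow {h : ℕ} (hh : 0 < h) {y : CoverGroup h} {k : ℤ} (hk : k ≠ 0)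
    (hc : IsConj y ((shift h ^ k) y)) : y = 1 := by
  have hnat : ∃ n : ℕ, 0 < n ∧ IsConj y ((shift h ^ n) y) := by
    rcases lt_or_gt_of_ne hk with hneg | hpos
    · refine ⟨(-k).toNat, by omega, ?_⟩
      have h1 := (shift h ^ (-k)).toMonoidHom.map_isConj hc
      simp only [MulEquiv.coe_toMonoidHom, ← MulAut.mul_apply, ← zpow_add, neg_add_cancel,
        zpow_zero, MulAut.one_apply] at h1
      rw [← zpow_natCast, Int.toNat_of_nonneg (by omega)]
      exact h1.symm
    · refine ⟨k.toNat, by omega, ?_⟩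
      rwa [← zpow_natCast, Int.toNat_of_nonneg (by omega)]
  obtain ⟨n, hn, hc⟩ := hnat
  obtain ⟨N, M, hNM⟩ := exists_restrict_shift_eq y
  have hall : ∀ j : ℕ, IsConj y ((shift h ^ (n * j)) y) := by
    intro j
    induction j with
    | zero => simpa using IsConj.refl y
    | succ j ih =>
      have h1 := (shift h ^ n).toMonoidHom.map_isConj ih
      simp only [MulEquiv.coe_toMonoidHom, ← MulAut.mul_apply, ← pow_add] at h1
      have h2 := hc.trans h1
      rwa [Nat.mul_succ, add_comm]
  -- The multiple `M + 2` makes the power `n * (M + 2)` large enough to clear the window `0..M`.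
  have h1 := (shift h ^ N).toMonoidHom.map_isConj (hall (M + 2))
  simp only [MulEquiv.coe_toMonoidHom, ← MulAut.mul_apply, ← pow_add] at h1
  rw [add_comm, pow_add, MulAut.mul_apply] at h1
  have h2 := eq_one_of_isConj_shift_pow hh hNM (Nat.le_mul_of_pos_left _ hn) h1
  simpa using h2

/-! ### The mapping torus: commutation transitivity and residual finiteness. -/

/-- The mapping torus of the shift. -/
abbrev ShiftTorus (h : ℕ) : Type :=
  CoverGroup h ⋊[zpowersHom (MulAut (CoverGroup h)) (shift h)] Multiplicative ℤ

theorem shiftTorus_left_eq_one {h : ℕ} (hh : 0 < h) {x y : ShiftTorus h} (hx : x.right = 1)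
    (hy : y.right ≠ 1) (hxy : Commute x y) : x = 1 := by
  have h1 := congrArg SemidirectProduct.left hxy.eq
  simp only [SemidirectProduct.mul_left, hx, map_one, MulAut.one_apply, zpowersHom_apply] at h1
  have h2 : x.left = 1 := by
    refine eq_one_of_isConj_shift_zpow hh (k := Multiplicative.toAdd y.right) hy ?_
    refine isConj_iff.2 ⟨y.left⁻¹, ?_⟩
    rw [mul_assoc, inv_inv, h1, inv_mul_cancel_left]
  exact SemidirectProduct.ext h2 hx

/-- If `y` is in the free fibre, so are `x` and `z`. Otherwise `⁅x, z⁆` lies in the fibre, because ℤ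
is abelian, and commutes with an element outside it, so it is trivial. -/
theorem shiftTorus_isCommTransitive {h : ℕ} (hh : 0 < h) : IsCommTransitive (ShiftTorus h) := by
  intro x y z hy hxy hyz
  by_cases hr : y.right = 1
  · have hx : x.right = 1 := by
      by_contra hx
      exact hy (shiftTorus_left_eq_one hh hr hx hxy.symm)
    have hz : z.right = 1 := by
      by_contra hz
      exact hy (shiftTorus_left_eq_one hh hr hz hyz)
    have hinl : ∀ w : ShiftTorus h, w.right = 1 → SemidirectProduct.inl w.left = w := by
      intro w hw
      exact SemidirectProduct.ext rfl hw.symm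
    rw [← hinl x hx, ← hinl y hr] at hxy
    rw [← hinl y hr, ← hinl z hz] at hyz
    rw [← hinl x hx, ← hinl z hz]
    refine Commute.map (freeGroup_isCommTransitive _ x.left y.left z.left ?_ ?_ ?_) _
    · intro h1
      exact hy (SemidirectProduct.ext h1 hr)
    · exact SemidirectProduct.inl_injective (by simpa using hxy.eq)
    · exact SemidirectProduct.inl_injective (by simpa using hyz.eq)
  · have h1 : ⁅x, z⁆ = 1 := by
      refine shiftTorus_left_eq_one hh (y := y) ?_ hr ?_
      · have := map_commutatorElement (SemidirectProduct.rightHom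
          (φ := zpowersHom (MulAut (CoverGroup h)) (shift h))) x z
        rw [commutatorElement_eq_one_iff_mul_comm.2
          (mul_comm (SemidirectProduct.rightHom x) (SemidirectProduct.rightHom z))] at this
        exact this
      · rw [commutatorElement_def]
        exact ((hxy.mul_left hyz.symm).mul_left hxy.inv_left).mul_left hyz.symm.inv_left
    exact commutatorElement_eq_one_iff_commute.1 h1

/-- Nontrivial elements of the cover are detected by finite representations that are invariant
under a power of the shift. -/
theorem exists_shift_invariant_perm_ne_one {h : ℕ} (hh : 0 < h) {f : CoverGroup h} (hf : f ≠ 1) :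
    ∃ (n : ℕ) (_ : 0 < n) (W : Type) (_ : Group W) (_ : Finite W) (ρ : CoverGroup h →* W),
      (∀ y, ρ ((shift h ^ n) y) = ρ y) ∧ ρ f ≠ 1 := by
  obtain ⟨N, M, hNM⟩ := exists_restrict_shift_eq f
  have hfN : (shift h ^ N) f ≠ 1 := by simpa using hf
  obtain ⟨B, ρ₀, hρ₀⟩ := freeGroup_exists_perm_ne_one hfN
  obtain ⟨ι, y, z, hι, hyz⟩ := exists_embedding_perm_commutator
    (ρ₀ ((shift h ^ (M + 1)) ag * ag⁻¹))
  -- Levels are read modulo `M + 2`. Residues `0..M` carry `ρ₀`; residue `M + 1` is a spare level,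
  -- whose commutator `⁅y, z⁆` is chosen to cancel the effect of `shift ^ (M + 1)` on `a`.
  let n : ℕ := M + 2
  let X : ℤ → Fin h × Bool → Equiv.Perm (B ⊕ B) := fun i p =>
    if i % n = M + 1 then firstPair y z p else ι (ρ₀ (xg (i % n) p))
  let ρ : CoverGroup h →* Equiv.Perm (B ⊕ B) := coverLift X (ι (ρ₀ ag))
  have hwin : ∀ u, restrict (Set.Icc (0 : ℤ) M) u = u → ρ u = ι (ρ₀ u) := by
    have : ρ.comp (restrict (Set.Icc (0 : ℤ) M)) =
        (ι.comp ρ₀).comp (restrict (Set.Icc (0 : ℤ) M)) := by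
      apply coverGroup_hom_ext
      · intro i p
        simp only [MonoidHom.comp_apply]
        by_cases hi : i ∈ Set.Icc (0 : ℤ) M
        · have hmod : i % n = i := Int.emod_eq_of_lt hi.1 (by have := hi.2; simp only [n]; omega)
          rw [restrict_xg_mem hi, coverLift_xg]
          simp only [X, hmod]
          rw [if_neg (by have := hi.2; omega)]
        · simp only [restrict_xg_notMem hi, map_one]
      · simp only [MonoidHom.comp_apply, restrict_ag]
        exact coverLift_ag _ _
    intro u hu
    have h1 := DFunLike.congr_fun this u
    simpa only [MonoidHom.comp_apply, hu] using h1
  have hinv : ρ.comp (shift h ^ n).toMonoidHom = ρ := by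
    apply coverGroup_hom_ext
    · intro i p
      simp only [MonoidHom.comp_apply, MulEquiv.coe_toMonoidHom, shift_pow_xg, ρ, coverLift_xg, X,
        Int.add_emod_right]
    · simp only [MonoidHom.comp_apply, MulEquiv.coe_toMonoidHom]
      have hlevel : ρ (levelProd ((M + 1 : ℕ) : ℤ)) = ⁅y, z⁆ := by
        rw [map_levelProd, ← commProd_firstPair hh y z]
        congr 1
        funext p
        have hmod : ((M + 1 : ℕ) : ℤ) % n = M + 1 := by
          rw [Int.emod_eq_of_lt (by omega) (by simp only [n]; omega)]
          push_cast
          rfl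
        simp only [ρ, coverLift_xg, X, hmod, if_true]
      have ha : ρ ag = ι (ρ₀ ag) := coverLift_ag _ _
      rw [shift_pow_succ_ag, map_mul, map_inv, hlevel, ← hyz,
        hwin _ (restrict_shift_pow_ag _ (by push_cast; rfl)), ha]
      simp
  refine ⟨n, by omega, _, inferInstance, inferInstance,
    ρ.comp (shift h ^ N).toMonoidHom, fun u => ?_, ?_⟩
  · have h1 := DFunLike.congr_fun hinv ((shift h ^ N) u)
    simp only [MonoidHom.comp_apply, MulEquiv.coe_toMonoidHom, ← MulAut.mul_apply, ← pow_add]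
      at h1 ⊢
    rwa [add_comm]
  · rw [MonoidHom.comp_apply, MulEquiv.coe_toMonoidHom, hwin _ hNM]
    intro h1
    exact hρ₀ (hι (h1.trans (map_one ι).symm))

/-- A homomorphism invariant under `e` is invariant under the powers of `e`. -/
theorem map_zpow_apply_of_invariant {F W : Type*} [Group F] [Group W] {ρ : F →* W} {e : MulAut F}
    (he : ∀ y, ρ (e y) = ρ y) (j : ℤ) (y : F) : ρ ((e ^ j) y) = ρ y := by
  induction j with
  | zero => simp
  | succ j ih => rw [add_comm, zpow_add, zpow_one, MulAut.mul_apply, he, ih]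
  | pred j ih => rw [← ih, ← he, ← MulAut.mul_apply, ← zpow_one_add]; simp

/-- Elements outside the fibre survive in a finite cyclic quotient. For the fibre, a representation
invariant under `shift ^ n` extends to the finite-index subgroup over nℤ by ignoring the
ℤ-coordinate. -/
instance shiftTorus_residuallyFinite {h : ℕ} [NeZero h] :
    Group.ResiduallyFinite (ShiftTorus h) := by
  have hh : 0 < h := Nat.pos_of_ne_zero (NeZero.ne h)
  rw [Group.residuallyFinite_iff_exists_finiteIndex]
  intro w hw
  let r (n : ℕ) : ShiftTorus h →* Multiplicative (ZMod n) :=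
    (AddMonoidHom.toMultiplicative (Int.castAddHom (ZMod n))).comp SemidirectProduct.rightHom
  have hr : ∀ n (v : ShiftTorus h), v ∈ (r n).ker ↔ (n : ℤ) ∣ Multiplicative.toAdd v.right := by
    intro n v
    rw [MonoidHom.mem_ker, ← ZMod.intCast_zmod_eq_zero_iff_dvd]
    exact Iff.rfl
  have hfin : ∀ n, 0 < n → (r n).ker.FiniteIndex := by
    intro n hn
    have : NeZero n := ⟨hn.ne'⟩
    have : Finite (Multiplicative (ZMod n)) := inferInstanceAs (Finite (ZMod n))
    infer_instance
  by_cases hright : w.right = 1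
  · have hleft : w.left ≠ 1 := fun h1 => hw (SemidirectProduct.ext h1 hright)
    obtain ⟨n, hn, W, _, _, ρ, hρ, hne⟩ := exists_shift_invariant_perm_ne_one hh hleft
    have := hfin n hn
    let θ : (r n).ker →* W :=
      { toFun := fun v => ρ v.1.left
        map_one' := map_one ρ
        map_mul' := by
          rintro ⟨u, hu⟩ ⟨v, hv⟩
          obtain ⟨j, hj⟩ := (hr n u).1 hu
          simp only [MulMemClass.mk_mul_mk, SemidirectProduct.mul_left, map_mul,
            zpowersHom_apply, hj, zpow_mul, zpow_natCast]
          rw [map_zpow_apply_of_invariant hρ] }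
    refine ⟨θ.ker.map (r n).ker.subtype, ⟨?_⟩, ?_⟩
    · rw [Subgroup.index_map_subtype]
      exact mul_ne_zero (Subgroup.finiteIndex_ker θ).index_ne_zero this.index_ne_zero
    · rintro ⟨v, hv, rfl⟩
      exact hne hv
  · have hne : Multiplicative.toAdd w.right ≠ 0 := hright
    refine ⟨(r ((Multiplicative.toAdd w.right).natAbs + 1)).ker, hfin _ (by omega), ?_⟩
    rw [hr]
    intro hdvd
    have := Int.le_of_dvd (abs_pos.2 hne) ((dvd_abs _ _).2 hdvd)
    rw [Int.abs_eq_natAbs] at this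
    omega

/-! ### The surface group inside the mapping torus. -/

/-- The index of the first generator. -/
def idxT (h : ℕ) : Fin (2 * (h + 1)) := ⟨0, by omega⟩

/-- The index of the second generator. -/
def idxA (h : ℕ) : Fin (2 * (h + 1)) := ⟨1, by omega⟩

/-- The generator index of the letter `(l, b)` among the last `2h` of `2(h + 1)` generators. -/
def letter {h : ℕ} (p : Fin h × Bool) : Fin (2 * (h + 1)) :=
  ⟨2 * (p.1.val + 1) + p.2.toNat, by
    have := p.1.isLt
    have := p.2.toNat_le
    omega⟩

theorem eq_letter {h : ℕ} (i : Fin (2 * (h + 1))) :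
    i = idxT h ∨ i = idxA h ∨ ∃ p : Fin h × Bool, i = letter p := by
  by_cases h0 : i.val = 0
  · exact Or.inl (Fin.ext h0)
  by_cases h1 : i.val = 1
  · exact Or.inr (Or.inl (Fin.ext h1))
  refine Or.inr (Or.inr ⟨(⟨i.val / 2 - 1, by omega⟩, decide (i.val % 2 = 1)), Fin.ext ?_⟩)
  by_cases h2 : i.val % 2 = 1 <;> simp [letter, h2] <;> omega

theorem lift_surfaceRelator_succ {H : Type*} [Group H] {h : ℕ} (f : Fin (2 * (h + 1)) → H) :
    FreeGroup.lift f (surfaceRelator (h + 1)) =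
      ⁅f (idxT h), f (idxA h)⁆ * commProd fun p => f (letter p) := by
  rw [surfaceRelator, List.finRange_succ, List.map_cons, List.prod_cons, map_mul, List.map_map,
    map_list_prod, List.map_map, commProd]
  congr 1
  · simp [map_commutatorElement, idxT, idxA]
  · congr 2
    funext l
    simp [map_commutatorElement, letter]

/-- Values on the generators, split into those on the first pair and the others. -/
def genValues {H : Type*} {h : ℕ} (t a : H) (x : Fin h × Bool → H) (i : Fin (2 * (h + 1))) : H :=
  if i.val = 0 then t else if hi : i.val ≤ 1 then a else
    x (⟨i.val / 2 - 1, by omega⟩, decide (i.val % 2 = 1))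

theorem genValues_letter {H : Type*} {h : ℕ} (t a : H) (x : Fin h × Bool → H)
    (p : Fin h × Bool) : genValues t a x (letter p) = x p := by
  obtain ⟨l, b⟩ := p
  have h1 : ∀ b : Bool, (2 * (l.val + 1) + b.toNat) / 2 - 1 = l.val := by
    intro b
    cases b
    · simp
    · simp
      omega
  rw [genValues, if_neg (by simp [letter]), dif_neg (by simp [letter]; omega)]
  congr 1
  refine Prod.ext (Fin.ext (h1 b)) ?_
  cases b <;> simp [letter]

theorem genValues_idxT {H : Type*} {h : ℕ} (t a : H) (x : Fin h × Bool → H) :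
    genValues t a x (idxT h) = t :=
  if_pos rfl

theorem genValues_idxA {H : Type*} {h : ℕ} (t a : H) (x : Fin h × Bool → H) :
    genValues t a x (idxA h) = a := by
  rw [genValues, if_neg (by simp [idxA]), dif_pos (show (idxA h).val ≤ 1 from le_rfl)]

/-- The surface group maps to the mapping torus of the shift. -/
def toTorus (h : ℕ) : SurfaceGroup (h + 1) →* ShiftTorus h :=
  PresentedGroup.toGroup
    (f := genValues (SemidirectProduct.inr (Multiplicative.ofAdd 1)) (SemidirectProduct.inl ag)
      fun p => SemidirectProduct.inl (xg 0 p))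
    (by
      intro r hr
      rw [Set.mem_singleton_iff.1 hr, lift_surfaceRelator_succ]
      simp only [genValues_letter, genValues_idxT, genValues_idxA]
      have h1 := SemidirectProduct.inl_aut (φ := zpowersHom (MulAut (CoverGroup h)) (shift h))
        (Multiplicative.ofAdd 1) ag
      rw [zpowersHom_apply, toAdd_ofAdd, zpow_one, shift_ag] at h1
      rw [← map_commProd, commutatorElement_def]
      rw [map_inv] at h1
      rw [← h1]
      simp [levelProd, mul_assoc])

theorem toTorus_letter {h : ℕ} (p : Fin h × Bool) :
    toTorus h (gen (h + 1) (letter p)) = SemidirectProduct.inl (xg 0 p) := by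
  simp [toTorus, gen, genValues_letter]

theorem gen_relation (h : ℕ) :
    ⁅gen (h + 1) (idxT h), gen (h + 1) (idxA h)⁆ *
      commProd (fun p => gen (h + 1) (letter p)) = 1 := by
  rw [← lift_surfaceRelator_succ]
  have h1 : FreeGroup.lift (gen (h + 1)) = PresentedGroup.mk {surfaceRelator (h + 1)} := by
    apply FreeGroup.ext_hom
    intro i
    simp [gen, PresentedGroup.of]
  rw [h1]
  exact PresentedGroup.one_of_mem rfl

/-- The restriction to the cover of the left inverse of `toTorus`. -/
def ofCover (h : ℕ) : CoverGroup h →* SurfaceGroup (h + 1) :=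
  coverLift (fun i p => gen (h + 1) (idxT h) ^ i * gen (h + 1) (letter p) *
    (gen (h + 1) (idxT h) ^ i)⁻¹) (gen (h + 1) (idxA h))

/-- On the letter `a` this is the surface relation solved for `t a t⁻¹`. -/
theorem ofCover_shift {h : ℕ} (y : CoverGroup h) :
    ofCover h (shift h y) = gen (h + 1) (idxT h) * ofCover h y *
      (gen (h + 1) (idxT h))⁻¹ := by
  have : (ofCover h).comp (shift h).toMonoidHom =
      (MulAut.conj (gen (h + 1) (idxT h))).toMonoidHom.comp (ofCover h) := by
    apply coverGroup_hom_ext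
    · intro i p
      simp only [MonoidHom.comp_apply, MulEquiv.coe_toMonoidHom, shift_xg, ofCover, coverLift_xg,
        MulAut.conj_apply]
      rw [zpow_add_one]
      group
    · simp only [MonoidHom.comp_apply, MulEquiv.coe_toMonoidHom, shift_ag, MulAut.conj_apply,
        map_mul, map_inv, map_levelProd]
      simp only [ofCover, coverLift_xg, coverLift_ag, zpow_zero, inv_one, mul_one, one_mul]
      rw [← eq_inv_of_mul_eq_one_left (gen_relation h), commutatorElement_def,
        inv_mul_cancel_right]
  exact DFunLike.congr_fun this y

theorem ofCover_shift_zpow {h : ℕ} (j : ℤ) (y : CoverGroup h) :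
    ofCover h ((shift h ^ j) y) = gen (h + 1) (idxT h) ^ j * ofCover h y *
      (gen (h + 1) (idxT h) ^ j)⁻¹ := by
  induction j with
  | zero => simp
  | succ j ih =>
    rw [add_comm (j : ℤ), zpow_one_add, MulAut.mul_apply, ofCover_shift, ih, zpow_one_add]
    group
  | pred j ih =>
    have h1 := ofCover_shift ((shift h ^ (-(j : ℤ) - 1)) y)
    rw [← MulAut.mul_apply, ← zpow_one_add, add_sub_cancel, ih] at h1
    have h2 := eq_inv_mul_of_mul_eq (eq_mul_inv_iff_mul_eq.1 h1).symm
    rw [h2]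
    group

/-- The left inverse of `toTorus`. -/
def ofTorus (h : ℕ) : ShiftTorus h →* SurfaceGroup (h + 1) :=
  SemidirectProduct.lift (ofCover h) (zpowersHom _ (gen (h + 1) (idxT h))) (by
    intro k
    ext y
    simp only [MonoidHom.comp_apply, MulEquiv.coe_toMonoidHom, zpowersHom_apply,
      ofCover_shift_zpow, MulAut.conj_apply])

theorem toTorus_injective (h : ℕ) : Function.Injective (toTorus h) := by
  have : (ofTorus h).comp (toTorus h) = MonoidHom.id _ := by
    apply PresentedGroup.ext
    intro i
    rcases eq_letter i with rfl | rfl | ⟨p, rfl⟩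
    · simp [toTorus, genValues_idxT, ofTorus, gen]
    · simp [toTorus, genValues_idxA, ofTorus, gen, ofCover]
    · simp [toTorus, genValues_letter, ofTorus, gen, ofCover]
  intro u v huv
  have h1 := congrArg (ofTorus h) huv
  rwa [← MonoidHom.comp_apply, ← MonoidHom.comp_apply, this] at h1

theorem surfaceGroup_isCommTransitive {g : ℕ} (hg : 2 ≤ g) :
    IsCommTransitive (SurfaceGroup g) := by
  obtain ⟨h, rfl⟩ : ∃ h, g = h + 1 := ⟨g - 1, by omega⟩
  exact (shiftTorus_isCommTransitive (by omega)).of_injective _ (toTorus_injective h)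

/-- Genus at least two leaves a second pair of generators, which become free letters in the cover.
-/
theorem surfaceGroup_exists_not_commute {g : ℕ} (hg : 2 ≤ g) :
    ∃ a b : SurfaceGroup g, ¬ Commute a b := by
  obtain ⟨h, rfl⟩ : ∃ h, g = h + 2 := ⟨g - 2, by omega⟩
  refine ⟨gen _ (letter ((0 : Fin (h + 1)), false)), gen _ (letter ((0 : Fin (h + 1)), true)),
    fun hc => ?_⟩
  have h1 := (hc.map (toTorus (h + 1))).eq
  rw [toTorus_letter, toTorus_letter, ← map_mul, ← map_mul, SemidirectProduct.inl_inj] at h1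
  have h2 := congrArg (coverLift (h := h + 1) (fun _ => firstPair
    (Equiv.swap 0 1 : Equiv.Perm (Fin 3)) (Equiv.swap 1 2)) 1) h1
  have h3 : (Equiv.swap 0 1 : Equiv.Perm (Fin 3)) * Equiv.swap 1 2 =
      Equiv.swap 1 2 * Equiv.swap 0 1 := by
    simpa [firstPair] using h2
  exact absurd h3 (by decide)

theorem surfaceGroup_isHopfian {g : ℕ} (hg : 2 ≤ g) : IsHopfian (SurfaceGroup g) := by
  obtain ⟨h, rfl⟩ : ∃ h, g = h + 1 := ⟨g - 1, by omega⟩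
  have : NeZero h := ⟨by omega⟩
  have : Group.ResiduallyFinite (SurfaceGroup (h + 1)) := by
    rw [Group.residuallyFinite_iff_forall_finiteIndex]
    intro w hw
    apply toTorus_injective h
    rw [map_one]
    refine Group.residuallyFinite_iff_forall_finiteIndex.1 shiftTorus_residuallyFinite _ ?_
    intro H hH
    have : (H.comap (toTorus h)).FiniteIndex :=
      ⟨by rw [Subgroup.index_comap]; exact Subgroup.FiniteIndex.index_ne_zero (H := H.subgroupOf _)⟩
    exact hw (H.comap (toTorus h))
  exact isHopfian_of_residuallyFinite _ (gen (h + 1)) (PresentedGroup.closure_range_of _)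

/-! ### Endomorphisms of the product with ℤ^m. -/

theorem map_eq_vecMul {m n : ℕ} (L : (Fin m → ℤ) →+ (Fin n → ℤ)) (a : Fin m → ℤ) :
    L a = Matrix.vecMul a (Matrix.of fun i => L (Pi.single i 1)) := by
  have h1 := LinearMap.pi_apply_eq_sum_univ L.toIntLinearMap a
  rw [Matrix.vecMul_eq_sum]
  refine h1.trans (Finset.sum_congr rfl fun i _ => ?_)
  congr 1
  change L _ = L _
  congr 1
  funext j
  simp [Pi.single_apply, eq_comm]

theorem exists_eq_firstKind {g m : ℕ} (Ψ : SurfaceAb g m →* SurfaceAb g m)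
    (hΨ : ∀ a, (Ψ (1, a)).1 = 1) : ∃ φ Q P, Ψ = firstKind φ Q P := by
  let φ : SurfaceGroup g →* SurfaceGroup g :=
    ((MonoidHom.fst _ _).comp Ψ).comp (MonoidHom.inl _ _)
  let α : SurfaceGroup g →* FreeAb m := ((MonoidHom.snd _ _).comp Ψ).comp (MonoidHom.inl _ _)
  let β : FreeAb m →* FreeAb m := ((MonoidHom.snd _ _).comp Ψ).comp (MonoidHom.inr _ _)
  let L : (Fin m → ℤ) →+ (Fin m → ℤ) := MonoidHom.toAdditive β
  let P : Matrix (Fin (2 * g)) (Fin m) ℤ := Matrix.of fun i => Multiplicative.toAdd (α (gen g i))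
  refine ⟨φ, Matrix.of fun i => L (Pi.single i 1), P, MonoidHom.ext fun w => ?_⟩
  have hα : ∀ u, Multiplicative.toAdd (α u) = Matrix.vecMul (ab u) P := by
    let R : SurfaceGroup g →* FreeAb m :=
      (AddMonoidHom.toMultiplicative (Matrix.vecMulLinear P).toAddMonoidHom).comp (abHom g)
    have h : α = R := by
      apply PresentedGroup.ext
      intro i
      apply Multiplicative.toAdd.injective
      change Multiplicative.toAdd (α (gen g i)) = Matrix.vecMul (ab (gen g i)) P
      rw [ab_gen, Matrix.single_one_vecMul]
      rfl
    intro u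
    exact congrArg Multiplicative.toAdd (DFunLike.congr_fun h u)
  obtain ⟨u, a⟩ := w
  have hw : ((u, a) : SurfaceAb g m) = (1, a) * (u, 1) := by simp
  refine Prod.ext ?_ ?_
  · rw [hw, map_mul, Prod.fst_mul, hΨ, one_mul]
    simp [firstKind, φ]
  · apply Multiplicative.toAdd.injective
    rw [hw, map_mul, Prod.snd_mul, toAdd_mul, ← hw]
    exact congrArg₂ (· + ·) (map_eq_vecMul L (Multiplicative.toAdd a)) (hα u)

theorem vecMul_eq_zero_of_det_ne_zero {m : ℕ} {Q : Matrix (Fin m) (Fin m) ℤ} (hQ : Q.det ≠ 0)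
    {a : Fin m → ℤ} (ha : Matrix.vecMul a Q = 0) : a = 0 := by
  by_contra hne
  exact hQ (Matrix.exists_vecMul_eq_zero_iff.1 ⟨a, hne, ha⟩)

theorem firstKind_injective {g m : ℕ} {φ : SurfaceGroup g →* SurfaceGroup g}
    {Q : Matrix (Fin m) (Fin m) ℤ} (P : Matrix (Fin (2 * g)) (Fin m) ℤ)
    (hφ : Function.Injective φ) (hQ : Q.det ≠ 0) : Function.Injective (firstKind φ Q P) := by
  rw [injective_iff_map_eq_one]
  rintro ⟨u, a⟩ h
  have h1 : φ u = 1 := congrArg Prod.fst h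
  have hu : u = 1 := hφ (h1.trans (map_one φ).symm)
  subst hu
  have h2 : Matrix.vecMul (Multiplicative.toAdd a) Q + Matrix.vecMul (ab 1) P = 0 :=
    congrArg (fun w => Multiplicative.toAdd w.2) h
  rw [ab_one, Matrix.zero_vecMul, add_zero] at h2
  exact Prod.ext rfl (Multiplicative.toAdd.injective (vecMul_eq_zero_of_det_ne_zero hQ h2))

theorem exists_firstKind_of_injective {g m : ℕ} (hg : 2 ≤ g) {Ψ : SurfaceAb g m →* SurfaceAb g m}
    (hΨ : Function.Injective Ψ) :
    ∃ φ Q P, Ψ = firstKind φ Q P ∧ Function.Injective φ ∧ Q.det ≠ 0 := by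
  have hCT := surfaceGroup_isCommTransitive hg
  obtain ⟨x, y, hxy⟩ := surfaceGroup_exists_not_commute hg
  -- The ℤ^m-components commute automatically, so injectivity reflects commutation of the surface
  -- components alone.
  have hreflect : ∀ u v : SurfaceGroup g, Commute (Ψ (u, 1)).1 (Ψ (v, 1)).1 → Commute u v := by
    intro u v h
    have h1 : Commute (Ψ (u, 1)) (Ψ (v, 1)) := Prod.ext h.eq (mul_comm _ _)
    have h2 := hΨ (by simpa only [map_mul] using h1.eq : Ψ ((u, 1) * (v, 1)) = Ψ ((v, 1) * (u, 1)))
    exact congrArg Prod.fst h2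
  obtain ⟨φ, Q, P, rfl⟩ := exists_eq_firstKind Ψ (by
    intro a
    by_contra hne
    have hcomm : ∀ u : SurfaceGroup g, Commute (Ψ (u, 1)).1 (Ψ (1, a)).1 := by
      intro u
      have h1 : Commute ((u, 1) : SurfaceAb g m) (1, a) := Prod.ext (by simp) (mul_comm _ _)
      exact (h1.map Ψ).map (MonoidHom.fst _ _)
    exact hxy (hreflect x y (hCT _ _ _ hne (hcomm x) (hcomm y).symm)))
  refine ⟨φ, Q, P, rfl, ?_, ?_⟩
  · rw [injective_iff_map_eq_one]
    intro u hu
    refine hCT.eq_one_of_central hxy fun v => hreflect v u ?_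
    change Commute (φ v) (φ u)
    rw [hu]
    exact Commute.one_right _
  · intro hdet
    obtain ⟨v, hv, hvQ⟩ := Matrix.exists_vecMul_eq_zero_iff.2 hdet
    have h1 : firstKind φ Q P (1, Multiplicative.ofAdd v) = 1 := by
      refine Prod.ext (map_one φ) ?_
      apply Multiplicative.toAdd.injective
      change Matrix.vecMul v Q + Matrix.vecMul (ab 1) P = 0
      rw [hvQ, ab_one, Matrix.zero_vecMul, add_zero]
    have h2 := hΨ (h1.trans (map_one _).symm)
    exact hv (congrArg (fun w : SurfaceAb g m => Multiplicative.toAdd w.2) h2)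

theorem surjective_of_firstKind_surjective {g m : ℕ} {φ : SurfaceGroup g →* SurfaceGroup g}
    {Q : Matrix (Fin m) (Fin m) ℤ} {P : Matrix (Fin (2 * g)) (Fin m) ℤ}
    (h : Function.Surjective (firstKind φ Q P)) : Function.Surjective φ := by
  intro s
  obtain ⟨w, hw⟩ := h (s, 1)
  exact ⟨w.1, congrArg Prod.fst hw⟩

theorem ab_surjective (g : ℕ) : Function.Surjective (ab : SurfaceGroup g → Fin (2 * g) → ℤ) := by
  have h : (abHom g).range = ⊤ := by
    rw [eq_top_iff]
    intro v _
    have hv : v = ∏ i, abHom g (gen g i) ^ (Multiplicative.toAdd v i) := by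
      apply Multiplicative.toAdd.injective
      rw [toAdd_prod]
      funext j
      have : ∀ i, Multiplicative.toAdd (abHom g (gen g i)) = Pi.single i 1 := ab_gen
      simp [this, Finset.sum_apply, Pi.single_apply]
    rw [hv]
    exact prod_mem fun i _ => zpow_mem (MonoidHom.mem_range.2 ⟨gen g i, rfl⟩) _
  intro v
  obtain ⟨u, hu⟩ := MonoidHom.range_eq_top.1 h (Multiplicative.ofAdd v)
  exact ⟨u, congrArg Multiplicative.toAdd hu⟩

theorem isUnit_abMatrix {g : ℕ} {φ : SurfaceGroup g →* SurfaceGroup g}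
    (hφ : Function.Surjective φ) : IsUnit (abMatrix φ) := by
  rw [← Matrix.vecMul_surjective_iff_isUnit]
  intro v
  obtain ⟨u, rfl⟩ := ab_surjective g v
  obtain ⟨u, rfl⟩ := hφ u
  exact ⟨ab u, (ab_map φ u).symm⟩

/-- A preimage `(u, a)` of `(1, v)` has `φ u = 1`, so `ab u` is killed by the invertible `abMatrix
φ` and vanishes; `P` drops out and `aQ = v`. -/
theorem isUnit_of_firstKind_surjective {g m : ℕ} {φ : SurfaceGroup g →* SurfaceGroup g}
    {Q : Matrix (Fin m) (Fin m) ℤ} {P : Matrix (Fin (2 * g)) (Fin m) ℤ}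
    (h : Function.Surjective (firstKind φ Q P)) : IsUnit Q := by
  have hM := isUnit_abMatrix (surjective_of_firstKind_surjective h)
  rw [← Matrix.vecMul_surjective_iff_isUnit]
  intro v
  obtain ⟨w, hw⟩ := h (1, Multiplicative.ofAdd v)
  have h1 : φ w.1 = 1 := congrArg Prod.fst hw
  have h2 : Matrix.vecMul (Multiplicative.toAdd w.2) Q + Matrix.vecMul (ab w.1) P = v :=
    congrArg (fun w => Multiplicative.toAdd w.2) hw
  have h3 : ab w.1 = 0 := by
    have h4 := ab_map φ w.1
    rw [h1, ab_one] at h4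
    exact vecMul_eq_zero_of_det_ne_zero ((Matrix.isUnit_iff_isUnit_det _).1 hM).ne_zero h4.symm
  rw [h3, Matrix.zero_vecMul, add_zero] at h2
  exact ⟨_, h2⟩

theorem isUnit_iff_det {m : ℕ} (Q : Matrix (Fin m) (Fin m) ℤ) :
    IsUnit Q ↔ Q.det = 1 ∨ Q.det = -1 := by
  rw [Matrix.isUnit_iff_isUnit_det, Int.isUnit_iff]

theorem firstKind_surjective {g m : ℕ} {φ : SurfaceGroup g →* SurfaceGroup g}
    {Q : Matrix (Fin m) (Fin m) ℤ} (P : Matrix (Fin (2 * g)) (Fin m) ℤ)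
    (hφ : Function.Surjective φ) (hQ : IsUnit Q) : Function.Surjective (firstKind φ Q P) := by
  rintro ⟨s, a⟩
  obtain ⟨u, rfl⟩ := hφ s
  obtain ⟨b, hb⟩ := Matrix.vecMul_surjective_iff_isUnit.2 hQ
    (Multiplicative.toAdd a - Matrix.vecMul (ab u) P)
  refine ⟨(u, Multiplicative.ofAdd b), Prod.ext rfl ?_⟩
  apply Multiplicative.toAdd.injective
  change Matrix.vecMul b Q + Matrix.vecMul (ab u) P = Multiplicative.toAdd a
  rw [show Matrix.vecMul b Q = _ from hb, sub_add_cancel]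

theorem exists_firstKind_of_surjective {g m : ℕ} (hg : 2 ≤ g) {Ψ : SurfaceAb g m →* SurfaceAb g m}
    (hΨ : Function.Surjective Ψ) :
    ∃ φ Q P, Ψ = firstKind φ Q P ∧ Function.Surjective φ ∧ IsUnit Q := by
  obtain ⟨x, y, hxy⟩ := surfaceGroup_exists_not_commute hg
  obtain ⟨φ, Q, P, rfl⟩ := exists_eq_firstKind Ψ (by
    intro a
    refine (surfaceGroup_isCommTransitive hg).eq_one_of_central hxy fun s => ?_
    obtain ⟨w, hw⟩ := hΨ (s, 1)
    have h1 : Commute w (1, a) := Prod.ext (by simp) (mul_comm _ _)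
    have h2 := (h1.map Ψ).map (MonoidHom.fst _ _)
    rw [hw] at h2
    exact h2)
  exact ⟨φ, Q, P, rfl, surjective_of_firstKind_surjective hΨ, isUnit_of_firstKind_surjective hΨ⟩

theorem surfaceAb_isHopfian {g : ℕ} (m : ℕ) (hg : 2 ≤ g) : IsHopfian (SurfaceAb g m) := by
  intro Ψ hΨ
  obtain ⟨φ, Q, P, rfl, hφ, hQ⟩ := exists_firstKind_of_surjective hg hΨ
  exact ⟨firstKind_injective P (surfaceGroup_isHopfian hg φ hφ).1
    ((Matrix.isUnit_iff_isUnit_det _).1 hQ).ne_zero, hΨ⟩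

/-- Doubling ℤ^m has determinant `2 ^ m`, which is nonzero but not a unit when `m ≥ 1`. -/
theorem surfaceAb_not_isCoHopfian (g : ℕ) {m : ℕ} (hm : 1 ≤ m) :
    ¬ IsCoHopfian (SurfaceAb g m) := by
  intro h
  have hdet : ((2 : ℤ) • (1 : Matrix (Fin m) (Fin m) ℤ)).det = 2 ^ m := by
    rw [Matrix.det_smul, Matrix.det_one, mul_one, Fintype.card_fin]
  have h1 := h (firstKind (MonoidHom.id _) ((2 : ℤ) • 1) 0)
    (firstKind_injective _ Function.injective_id (by rw [hdet]; positivity))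
  have h2 := (Matrix.isUnit_iff_isUnit_det _).1 (isUnit_of_firstKind_surjective h1.2)
  rw [hdet, isUnit_pow_iff (by omega), Int.isUnit_iff] at h2
  omega

/-- A right inverse suffices, since bijectivity is known separately. The abelianization of `e.symm
u` is `u M⁻¹`, so its term `u M⁻¹ P` cancels `-u M⁻¹ P Q⁻¹ Q`. -/
theorem firstKind_apply_inverse {g m : ℕ} (e : SurfaceGroup g ≃* SurfaceGroup g)
    {Q : Matrix (Fin m) (Fin m) ℤ} (P : Matrix (Fin (2 * g)) (Fin m) ℤ) (hQ : IsUnit Q)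
    (hM : IsUnit (abMatrix e.toMonoidHom)) (w : SurfaceAb g m) :
    firstKind e.toMonoidHom Q P (firstKind e.symm.toMonoidHom Q⁻¹
      (-((abMatrix e.toMonoidHom)⁻¹ * P * Q⁻¹)) w) = w := by
  obtain ⟨u, a⟩ := w
  have hQ' := (Matrix.isUnit_iff_isUnit_det _).1 hQ
  have hM' := (Matrix.isUnit_iff_isUnit_det _).1 hM
  refine Prod.ext (e.apply_symm_apply u) ?_
  apply Multiplicative.toAdd.injective
  change Matrix.vecMul (Matrix.vecMul (Multiplicative.toAdd a) Q⁻¹ +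
      Matrix.vecMul (ab u) (-((abMatrix e.toMonoidHom)⁻¹ * P * Q⁻¹))) Q +
      Matrix.vecMul (ab (e.symm u)) P = Multiplicative.toAdd a
  have h1 : ab (e.symm u) = Matrix.vecMul (ab u) (abMatrix e.toMonoidHom)⁻¹ := by
    have h2 := ab_map e.toMonoidHom (e.symm u)
    rw [MulEquiv.coe_toMonoidHom, e.apply_symm_apply] at h2
    rw [h2, Matrix.vecMul_vecMul, Matrix.mul_nonsing_inv _ hM', Matrix.vecMul_one]
  rw [h1, Matrix.add_vecMul, Matrix.vecMul_vecMul, Matrix.vecMul_vecMul, Matrix.vecMul_vecMul,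
    Matrix.nonsing_inv_mul _ hQ', Matrix.vecMul_one, Matrix.neg_mul, Matrix.mul_assoc _ Q⁻¹ Q,
    Matrix.nonsing_inv_mul _ hQ', Matrix.mul_one, Matrix.vecMul_neg, neg_add_cancel_right]

end SurfaceTimesAbelian

theorem mainTheorem9 (g m : ℕ) (hg : 2 ≤ g) (hm : 1 ≤ m) :
    -- (1) monomorphisms
    (∀ Ψ : SurfaceTimesAbelian.SurfaceAb g m →* SurfaceTimesAbelian.SurfaceAb g m,
      Function.Injective Ψ ↔
        ∃ (φ : SurfaceTimesAbelian.SurfaceGroup g →* SurfaceTimesAbelian.SurfaceGroup g)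
          (Q : Matrix (Fin m) (Fin m) ℤ) (P : Matrix (Fin (2 * g)) (Fin m) ℤ),
          Ψ = SurfaceTimesAbelian.firstKind φ Q P ∧ Function.Injective φ ∧ Q.det ≠ 0) ∧
    -- (2) epimorphisms
    (∀ Ψ : SurfaceTimesAbelian.SurfaceAb g m →* SurfaceTimesAbelian.SurfaceAb g m,
      Function.Surjective Ψ ↔
        ∃ (φ : SurfaceTimesAbelian.SurfaceGroup g →* SurfaceTimesAbelian.SurfaceGroup g)
          (Q : Matrix (Fin m) (Fin m) ℤ) (P : Matrix (Fin (2 * g)) (Fin m) ℤ),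
          Ψ = SurfaceTimesAbelian.firstKind φ Q P ∧ Function.Surjective φ ∧
            (Q.det = 1 ∨ Q.det = -1)) ∧
    -- (3) automorphisms are the epimorphisms
    (∀ Ψ : SurfaceTimesAbelian.SurfaceAb g m →* SurfaceTimesAbelian.SurfaceAb g m,
      Function.Bijective Ψ ↔ Function.Surjective Ψ) ∧
    SurfaceTimesAbelian.IsHopfian (SurfaceTimesAbelian.SurfaceAb g m) ∧
    ¬ SurfaceTimesAbelian.IsCoHopfian (SurfaceTimesAbelian.SurfaceAb g m) ∧
    -- the inverse of an automorphism `Ψ_{φ,Q,P}`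
    (∀ (φ : SurfaceTimesAbelian.SurfaceGroup g →* SurfaceTimesAbelian.SurfaceGroup g)
      (Q : Matrix (Fin m) (Fin m) ℤ) (P : Matrix (Fin (2 * g)) (Fin m) ℤ),
      Function.Surjective (SurfaceTimesAbelian.firstKind φ Q P) →
        IsUnit Q ∧ IsUnit (SurfaceTimesAbelian.abMatrix φ) ∧
        ∃ (e : SurfaceTimesAbelian.SurfaceGroup g ≃* SurfaceTimesAbelian.SurfaceGroup g)
          (E : SurfaceTimesAbelian.SurfaceAb g m ≃* SurfaceTimesAbelian.SurfaceAb g m),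
          e.toMonoidHom = φ ∧
          E.toMonoidHom = SurfaceTimesAbelian.firstKind φ Q P ∧
          E.symm.toMonoidHom = SurfaceTimesAbelian.firstKind e.symm.toMonoidHom Q⁻¹
            (-((SurfaceTimesAbelian.abMatrix φ)⁻¹ * P * Q⁻¹))) := by
  refine ⟨fun Ψ => ⟨SurfaceTimesAbelian.exists_firstKind_of_injective hg, ?_⟩,
    fun Ψ => ⟨fun h => ?_, ?_⟩,
    fun Ψ => ⟨fun h => h.2, SurfaceTimesAbelian.surfaceAb_isHopfian m hg Ψ⟩,
    SurfaceTimesAbelian.surfaceAb_isHopfian m hg,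
    SurfaceTimesAbelian.surfaceAb_not_isCoHopfian g hm, fun φ Q P h => ?_⟩
  · rintro ⟨φ, Q, P, rfl, hφ, hQ⟩
    exact SurfaceTimesAbelian.firstKind_injective P hφ hQ
  · obtain ⟨φ, Q, P, hΨ, hφ, hQ⟩ := SurfaceTimesAbelian.exists_firstKind_of_surjective hg h
    exact ⟨φ, Q, P, hΨ, hφ, (SurfaceTimesAbelian.isUnit_iff_det Q).1 hQ⟩
  · rintro ⟨φ, Q, P, rfl, hφ, hQ⟩
    exact SurfaceTimesAbelian.firstKind_surjective P hφ
      ((SurfaceTimesAbelian.isUnit_iff_det Q).2 hQ)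
  · have hφ := SurfaceTimesAbelian.surjective_of_firstKind_surjective h
    have hQ := SurfaceTimesAbelian.isUnit_of_firstKind_surjective h
    have hM := SurfaceTimesAbelian.isUnit_abMatrix hφ
    let e := MulEquiv.ofBijective φ (SurfaceTimesAbelian.surfaceGroup_isHopfian hg φ hφ)
    let E := MulEquiv.ofBijective _ (SurfaceTimesAbelian.surfaceAb_isHopfian m hg _ h)
    refine ⟨hQ, hM, e, E, rfl, rfl, MonoidHom.ext fun w => ?_⟩
    exact E.symm_apply_eq.2 (SurfaceTimesAbelian.firstKind_apply_inverse e P hQ hM w).symm
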